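/- Setting. Let $\Theta$ and $U$ be compact metric spaces, $\Theta\neq\emptyset$, with their Borel $\sigma$-algebras, and let $\mathcal H$ be a complex Hilbert space. For a bounded operator $T$ on $\mathcal H$ let $\|T\|_1=\operatorname{Tr}|T|\in[0,\infty]$; $T$ is trace class if $\|T\|_1<\infty$. Let $\rho$ be a quantum statistical model on $\Theta$: each $\rho(\theta)$ is a trace-class operator with $\rho(\theta)\ge 0$ and $\operatorname{Tr}\rho(\theta)=1$; $\rho$ is injective; and $\rho$ is regular, i.e. for every compact $K\subseteq\Theta$, $$\lim_{\delta\downarrow 0}\ \inf\bigl\{\|X\|_1 : X \text{ trace class},\ -X\le\rho(\theta)-\rho(\eta)\le X\ \text{ for all }\theta,\eta\in K\text{ with }d(\theta,\eta)<\delta\bigr\}=0 .$$ A POVM on $U$ is a map $B\mapsto M(B)$ from the Borel sets of $U$ to the positive bounded operators on $\mathcal H$ with $M(U)=I$ that is countably additive in the weak operator topology. The set $\mathcal P_o(U)$ of all POVMs carries the coarsest topology for which $M\mapsto\int_U f(u)\operatorname{Tr}(T\,M(du))$ is continuous for every positive trace-class $T$ and every continuous $f:U\to\mathbb R$; it is convex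 under $(tM+(1-t)N)(B)=tM(B)+(1-t)N(B)$. A loss function is a lower semicontinuous function $w:\Theta\times U\to[0,+\infty]$. Put $$R_M(\theta)=\int_U w(\theta,u)\operatorname{Tr}(\rho(\theta)M(du)),$$ and let $\mathcal P(\Theta)$ be the set of Borel probability measures (priors) on $\Theta$. Let $\mathcal C\subseteq\mathcal P_o(U)$ be a nonempty closed convex set of POVMs. Within $\mathcal C$, a POVM $M\in\mathcal C$ is *minimax* if it minimizes $\sup_\theta R_M(\theta)$ over $\mathcal C$, and *Bayes with respect to* $\pi\in\mathcal P(\Theta)$ if it minimizes $\int R_M\,d\pi$ over $\mathcal C$; a prior $\pi_*$ is *least favorable* if $\inf_{M\in\mathcal C}\int R_M\,d\pi_*=\sup_{\pi\in\mathcal P(\Theta)}\inf_{M\in\mathcal C}\int R_M\,d\pi$. Corollary. 1. For every (bounded) continuous loss function $w:\Theta\times U\to[0,\infty)$, $$\inf_{M\in\mathcal C}\ \sup_{\theta\in\Theta}R_M(\theta)=\sup_{\pi\in\mathcal P(\Theta)}\ \inf_{M\in\mathcal C}\int_\Theta R_M(\theta)\,\pi(d\theta),$$ and the common value is finite. 2.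 The same equality (in $[0,+\infty]$) holds for every lower semicontinuous loss function $w:\Theta\times U\to[0,+\infty]$. 3. For every lower semicontinuous loss function $w:\Theta\times U\to[0,+\infty]$ there exists a POVM that is minimax in $\mathcal C$. 4. For every continuous loss function $w:\Theta\times U\to[0,\infty)$, every POVM that is minimax in $\mathcal C$ is Bayes in $\mathcal C$ with respect to some least favorable prior; and if, for a least favorable prior $\pi_*$, there is exactly one Bayes POVM in $\mathcal C$ with respect to $\pi_*$, then that POVM is minimax in $\mathcal C$. -/

import Mathlib

open MeasureTheory Filter Topology Set
open scoped ENNReal NNReal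

namespace QuantumDecision

noncomputable section

/-! ### Trace, trace norm and trace-class operators -/

section Trace

set_option linter.unusedSectionVars false

variable {H : Type*} [NormedAddCommGroup H] [InnerProductSpace ℂ H] [CompleteSpace H]

variable (H) in
/-- The index set of a fixed Hilbert basis of `H`. -/
def basisIndex : Set H := (exists_hilbertBasis ℂ H).choose

variable (H) in
/-- A fixed Hilbert basis of `H`, used to evaluate traces. -/
def stdBasis : HilbertBasis (basisIndex H) ℂ H := (exists_hilbertBasis ℂ H).choose_spec.choose

/-- The trace norm `‖T‖₁ = Tr |T| = ∑ᵢ ⟨eᵢ, |T| eᵢ⟩`, where `|T| = (T* T)^{1/2}`; it takes the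
value `∞` when `T` is not trace class. -/
def traceNorm (T : H →L[ℂ] H) : ℝ≥0∞ :=
  ∑' i, ENNReal.ofReal (inner ℂ (stdBasis H i) (CFC.abs T (stdBasis H i))).re

/-- `T` is a trace-class operator. -/
def IsTraceClass (T : H →L[ℂ] H) : Prop := traceNorm T ≠ ∞

/-- The trace `Tr T = ∑ᵢ ⟨eᵢ, T eᵢ⟩` of a trace-class operator. -/
def trace (T : H →L[ℂ] H) : ℂ := ∑' i, inner ℂ (stdBasis H i) (T (stdBasis H i))

theorem inner_re_nonneg {A : H →L[ℂ] H} (hA : 0 ≤ A) (x : H) : 0 ≤ (inner ℂ x (A x)).re :=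
  ((ContinuousLinearMap.nonneg_iff_isPositive A).1 hA).re_inner_nonneg_right x

theorem inner_eq_re {A : H →L[ℂ] H} (hA : 0 ≤ A) (x : H) :
    inner ℂ x (A x) = ((inner ℂ x (A x)).re : ℂ) := by
  have h := ((ContinuousLinearMap.nonneg_iff_isPositive A).1 hA).inner_nonneg_right x
  exact Complex.eq_re_of_ofReal_le (r := 0) (by simpa using h)

theorem sqrt_inner (T : H →L[ℂ] H) (x y : H) :
    inner ℂ (CFC.sqrt T x) y = inner ℂ x (CFC.sqrt T y) := by
  have h := (ContinuousLinearMap.nonneg_iff_isPositive _).1 (CFC.sqrt_nonneg T)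
  exact h.inner_left_eq_inner_right x y

/-- The square root of a positive trace-class operator is Hilbert--Schmidt. -/
theorem summable_sqrt {T : H →L[ℂ] H} (hT : 0 ≤ T) (hc : IsTraceClass T) :
    Summable fun i => ‖CFC.sqrt T (stdBasis H i)‖ ^ 2 := by
  have key : ∀ i, (inner ℂ (stdBasis H i) (CFC.abs T (stdBasis H i))).re
      = ‖CFC.sqrt T (stdBasis H i)‖ ^ 2 := by
    intro i
    rw [CFC.abs_of_nonneg T hT]
    conv_lhs => rw [← CFC.sqrt_mul_sqrt_self T hT]
    rw [mul_apply_eq_comp, ← sqrt_inner]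
    exact inner_self_eq_norm_sq (𝕜 := ℂ) _
  have h : (∑' i, ENNReal.ofReal (‖CFC.sqrt T (stdBasis H i)‖ ^ 2)) ≠ ∞ := by
    simpa only [IsTraceClass, traceNorm, key] using hc
  have h2 := ENNReal.summable_toReal h
  refine h2.congr fun i => ?_
  rw [ENNReal.toReal_ofReal (by positivity)]

theorem summable_basis_sq (x : H) : Summable fun j => ‖inner ℂ x (stdBasis H j)‖ ^ 2 := by
  have h := ((stdBasis H).summable_inner_mul_inner x x).norm
  refine h.congr fun j => ?_
  rw [norm_mul, ← inner_conj_symm (stdBasis H j) x, RCLike.norm_conj, sq]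

theorem tsum_basis_sq (x : H) : ∑' j, ‖inner ℂ x (stdBasis H j)‖ ^ 2 = ‖x‖ ^ 2 := by
  have h := ((stdBasis H).hasSum_inner_mul_inner x x)
  have h2 : ∀ j, inner ℂ x (stdBasis H j) * inner ℂ (stdBasis H j) x
      = ((‖inner ℂ x (stdBasis H j)‖ ^ 2 : ℝ) : ℂ) := by
    intro j
    rw [← inner_conj_symm (stdBasis H j) x, Complex.mul_conj, Complex.normSq_eq_norm_sq]
  simp only [h2] at h
  have h3 : inner ℂ x x = ((‖x‖ ^ 2 : ℝ) : ℂ) := by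
    rw [inner_self_eq_norm_sq_to_K]; simp
  rw [h3] at h
  exact (Complex.hasSum_ofReal.1 h).tsum_eq

theorem summable_matrix (B : H →L[ℂ] H) (h : Summable fun i => ‖B (stdBasis H i)‖ ^ 2) :
    Summable fun p : basisIndex H × basisIndex H =>
      ‖inner ℂ (B (stdBasis H p.1)) (stdBasis H p.2)‖ ^ 2 := by
  rw [summable_prod_of_nonneg (fun p => by positivity)]
  refine ⟨fun i => summable_basis_sq (B (stdBasis H i)), ?_⟩
  have e : (fun i => ‖B (stdBasis H i)‖ ^ 2) =
      fun i => ∑' j, ‖inner ℂ (B (stdBasis H i)) (stdBasis H j)‖ ^ 2 :=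
    funext fun i => (tsum_basis_sq (B (stdBasis H i))).symm
  rw [e] at h
  exact h

theorem summable_comp (A S : H →L[ℂ] H) (h : Summable fun i => ‖S (stdBasis H i)‖ ^ 2) :
    Summable fun i => ‖(A * S) (stdBasis H i)‖ ^ 2 := by
  refine Summable.of_nonneg_of_le (fun i => by positivity) (fun i => ?_) (h.mul_left (‖A‖ ^ 2))
  rw [← mul_pow]
  exact pow_le_pow_left₀ (norm_nonneg _) (A.le_opNorm _) 2

/-- `Tr (T A) = ∑ᵢ ⟨T^{1/2} eᵢ, A T^{1/2} eᵢ⟩` for a positive trace-class operator `T`. -/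
theorem trace_mul_eq {T : H →L[ℂ] H} (hT : 0 ≤ T) (hc : IsTraceClass T) (A : H →L[ℂ] H) :
    trace (T * A) = ∑' i, inner ℂ (CFC.sqrt T (stdBasis H i))
      (A (CFC.sqrt T (stdBasis H i))) := by
  have hsum := summable_sqrt hT hc
  have hSS : CFC.sqrt T * CFC.sqrt T = T := CFC.sqrt_mul_sqrt_self T hT
  have hsymm := sqrt_inner T
  generalize CFC.sqrt T = S at hsum hSS hsymm ⊢
  subst hSS
  have hF2 : ∀ i j, inner ℂ (stdBasis H j) (S (A (stdBasis H i)))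
      = inner ℂ ((ContinuousLinearMap.adjoint A * S) (stdBasis H j)) (stdBasis H i) := by
    intro i j
    rw [← hsymm]
    exact (ContinuousLinearMap.adjoint_inner_left A _ _).symm
  have hs1 := summable_matrix S hsum
  have hs2 := (summable_matrix _
    (summable_comp (ContinuousLinearMap.adjoint A) S hsum)).prod_symm
  have hF : Summable (Function.uncurry fun i j : basisIndex H =>
      inner ℂ (S (stdBasis H i)) (stdBasis H j) *
        inner ℂ (stdBasis H j) (S (A (stdBasis H i)))) := by
    refine Summable.of_norm_bounded (hs1.add hs2) (fun p => ?_)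
    obtain ⟨i, j⟩ := p
    simp only [Function.uncurry, Prod.swap]
    rw [norm_mul, hF2]
    generalize ‖inner ℂ (S (stdBasis H i)) (stdBasis H j)‖ = a
    generalize ‖inner ℂ ((ContinuousLinearMap.adjoint A * S) (stdBasis H j)) (stdBasis H i)‖ = b
    nlinarith [sq_nonneg (a - b), sq_nonneg a, sq_nonneg b]
  calc trace (S * S * A) = ∑' i, ∑' j, inner ℂ (S (stdBasis H i)) (stdBasis H j) *
        inner ℂ (stdBasis H j) (S (A (stdBasis H i))) := by
        refine tsum_congr fun i => ?_
        rw [(stdBasis H).tsum_inner_mul_inner, hsymm]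
        rfl
    _ = ∑' j, ∑' i, inner ℂ (S (stdBasis H i)) (stdBasis H j) *
        inner ℂ (stdBasis H j) (S (A (stdBasis H i))) := hF.tsum_comm.symm
    _ = _ := by
        refine tsum_congr fun j => ?_
        have h : ∀ i, inner ℂ (S (stdBasis H i)) (stdBasis H j) *
            inner ℂ (stdBasis H j) (S (A (stdBasis H i))) =
            inner ℂ ((ContinuousLinearMap.adjoint A * S) (stdBasis H j)) (stdBasis H i) *
              inner ℂ (stdBasis H i) (S (stdBasis H j)) := by
          intro i
          rw [hF2, hsymm, mul_comm]
        simp only [h]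
        rw [(stdBasis H).tsum_inner_mul_inner]
        exact ContinuousLinearMap.adjoint_inner_left A _ _

theorem summable_sqrt_inner {T : H →L[ℂ] H} (hT : 0 ≤ T) (hc : IsTraceClass T) (A : H →L[ℂ] H) :
    Summable fun i => (inner ℂ (CFC.sqrt T (stdBasis H i)) (A (CFC.sqrt T (stdBasis H i)))).re := by
  refine Summable.of_norm_bounded ((summable_sqrt hT hc).mul_left ‖A‖) (fun i => ?_)
  refine (Complex.abs_re_le_norm _).trans ((norm_inner_le_norm _ _).trans ?_)
  calc _ ≤ ‖CFC.sqrt T (stdBasis H i)‖ * (‖A‖ * ‖CFC.sqrt T (stdBasis H i)‖) := by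
        gcongr; exact A.le_opNorm _
    _ = _ := by ring

theorem trace_mul_eq_ofReal {T A : H →L[ℂ] H} (hT : 0 ≤ T) (hc : IsTraceClass T) (hA : 0 ≤ A) :
    trace (T * A) = ((∑' i, (inner ℂ (CFC.sqrt T (stdBasis H i))
      (A (CFC.sqrt T (stdBasis H i)))).re : ℝ) : ℂ) := by
  rw [trace_mul_eq hT hc, Complex.ofReal_tsum]
  exact tsum_congr fun i => inner_eq_re hA _

theorem ofReal_trace_mul {T A : H →L[ℂ] H} (hT : 0 ≤ T) (hc : IsTraceClass T) (hA : 0 ≤ A) :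
    ENNReal.ofReal (trace (T * A)).re = ∑' i, ENNReal.ofReal
      (inner ℂ (CFC.sqrt T (stdBasis H i)) (A (CFC.sqrt T (stdBasis H i)))).re := by
  rw [trace_mul_eq_ofReal hT hc hA, Complex.ofReal_re]
  exact ENNReal.ofReal_tsum_of_nonneg (fun i => inner_re_nonneg hA _) (summable_sqrt_inner hT hc A)

end Trace

/-! ### Measurements -/

/-- A positive-operator-valued measure (POVM) on the measurable sets of `U`.  Countable additivity
holds in the weak operator topology.  As for Mathlib's vector measures, the value on a
non-measurable set carries no information and is set to `0`. -/
@[ext]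
structure POVM (U H : Type*) [MeasurableSpace U] [NormedAddCommGroup H] [InnerProductSpace ℂ H]
    [CompleteSpace H] where
  /-- The operator `M(B)` attached to a set `B` of outcomes. -/
  toFun : Set U → H →L[ℂ] H
  nonneg : ∀ B, MeasurableSet B → 0 ≤ toFun B
  hasSum_iUnion : ∀ B : ℕ → Set U, (∀ j, MeasurableSet (B j)) →
    Pairwise (fun i j => Disjoint (B i) (B j)) →
    ∀ x y : H, HasSum (fun j => inner ℂ x (toFun (B j) y)) (inner ℂ x (toFun (⋃ j, B j) y))
  univ_eq_one : toFun univ = 1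
  eq_zero_of_not_measurable : ∀ B, ¬ MeasurableSet B → toFun B = 0

section Measurement

variable {U H : Type*} [MeasurableSpace U] [NormedAddCommGroup H] [InnerProductSpace ℂ H]
  [CompleteSpace H]

theorem POVM.toFun_empty (M : POVM U H) : M.toFun ∅ = 0 := by
  refine ContinuousLinearMap.ext fun y => ext_inner_left ℂ fun x => ?_
  have h := M.hasSum_iUnion (fun _ => ∅) (fun _ => MeasurableSet.empty)
    (fun _ _ _ => disjoint_bot_left) x y
  have h0 := tendsto_nhds_unique tendsto_const_nhds h.summable.tendsto_atTop_zero
  simpa using h0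

/-- The outcome distribution `B ↦ Tr (T M(B))` of a POVM `M`, for a positive trace-class operator
`T` (the Born rule when `T` is a density operator). -/
def POVM.bornMeasure (M : POVM U H) (T : H →L[ℂ] H) (hT : 0 ≤ T) (hc : IsTraceClass T) :
    Measure U :=
  Measure.ofMeasurable (fun B _ => ENNReal.ofReal (trace (T * M.toFun B)).re)
    (by simp [M.toFun_empty, trace])
    (by
      intro B hB hd
      have hU : MeasurableSet (⋃ j, B j) := MeasurableSet.iUnion hB
      simp only [ofReal_trace_mul hT hc (M.nonneg _ hU),
        fun j => ofReal_trace_mul hT hc (M.nonneg _ (hB j))]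
      rw [ENNReal.tsum_comm]
      refine tsum_congr fun i => ?_
      have h := Complex.hasSum_re (M.hasSum_iUnion B hB hd (CFC.sqrt T (stdBasis H i))
        (CFC.sqrt T (stdBasis H i)))
      rw [← h.tsum_eq]
      exact ENNReal.ofReal_tsum_of_nonneg (fun j => inner_re_nonneg (M.nonneg _ (hB j)) _)
        h.summable)

theorem POVM.bornMeasure_apply (M : POVM U H) (T : H →L[ℂ] H) (hT : 0 ≤ T)
    (hc : IsTraceClass T) {B : Set U} (hB : MeasurableSet B) :
    M.bornMeasure T hT hc B = ENNReal.ofReal (trace (T * M.toFun B)).re :=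
  Measure.ofMeasurable_apply B hB

/-- The coarsest topology on the set of POVMs that makes `M ↦ ∫ f(u) Tr (T M(du))` continuous for
every positive trace-class operator `T` and every continuous function `f`. -/
instance POVM.instTopologicalSpace [TopologicalSpace U] : TopologicalSpace (POVM U H) :=
  ⨅ (T : H →L[ℂ] H) (hT : 0 ≤ T) (hc : IsTraceClass T) (f : C(U, ℝ)),
    TopologicalSpace.induced (fun M : POVM U H => ∫ u, f u ∂(M.bornMeasure T hT hc)) inferInstance

/-- A set of POVMs is convex if it is stable under the mixtures
`B ↦ t M(B) + (1 - t) N(B)`, `0 ≤ t ≤ 1`. -/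
def IsConvexClass (C : Set (POVM U H)) : Prop :=
  ∀ M ∈ C, ∀ N ∈ C, ∀ t : ℝ, 0 ≤ t → t ≤ 1 →
    ∃ L ∈ C, ∀ B, L.toFun B = (t : ℂ) • M.toFun B + ((1 - t : ℝ) : ℂ) • N.toFun B

end Measurement

/-! ### Quantum statistical models -/

section Model

variable {Θ H : Type*} [MetricSpace Θ] [NormedAddCommGroup H] [InnerProductSpace ℂ H]
  [CompleteSpace H]

/-- The quantity `ω_T(K_δ)`: the infimum of `‖X‖₁` over the trace-class operators `X` such that
`-X ≤ T(θ) - T(η) ≤ X` for all `θ, η ∈ K` with `d(θ, η) < δ` (it is `∞` if there is none). -/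
def modulus (T : Θ → H →L[ℂ] H) (K : Set Θ) (δ : ℝ) : ℝ≥0∞ :=
  ⨅ (X : H →L[ℂ] H) (_ : IsTraceClass X)
    (_ : ∀ θ ∈ K, ∀ η ∈ K, dist θ η < δ → -X ≤ T θ - T η ∧ T θ - T η ≤ X), traceNorm X

/-- Regularity of an operator-valued function: `ω_T(K_δ) → 0` as `δ → 0`, for all compact `K`. -/
def IsRegular (T : Θ → H →L[ℂ] H) : Prop :=
  ∀ K : Set Θ, IsCompact K → Tendsto (fun δ : ℝ => modulus T K δ) (𝓝[>] 0) (𝓝 0)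

variable (Θ H) in
/-- An identifiable and regular quantum statistical model: a family of density operators. -/
structure QuantumModel where
  /-- The density operator with parameter `θ`. -/
  state : Θ → H →L[ℂ] H
  nonneg : ∀ θ, 0 ≤ state θ
  traceClass : ∀ θ, IsTraceClass (state θ)
  trace_eq_one : ∀ θ, trace (state θ) = 1
  identifiable : Function.Injective state
  regular : IsRegular state

end Model

/-! ### Risk and optimality -/

section Decision

variable {Θ U H : Type*} [MetricSpace Θ] [MeasurableSpace Θ] [MeasurableSpace U]
  [NormedAddCommGroup H] [InnerProductSpace ℂ H] [CompleteSpace H]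

/-- The risk function `R_M(θ) = ∫ w(θ, u) Tr (ρ(θ) M(du))`. -/
def risk (ρ : QuantumModel Θ H) (w : Θ × U → ℝ≥0∞) (M : POVM U H) (θ : Θ) : ℝ≥0∞ :=
  ∫⁻ u, w (θ, u) ∂(M.bornMeasure (ρ.state θ) (ρ.nonneg θ) (ρ.traceClass θ))

/-- The average risk `∫ R_M(θ) π(dθ)` with respect to the prior `π`. -/
def avgRisk (ρ : QuantumModel Θ H) (w : Θ × U → ℝ≥0∞) (M : POVM U H)
    (π : ProbabilityMeasure Θ) : ℝ≥0∞ :=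
  ∫⁻ θ, risk ρ w M θ ∂(π : Measure Θ)

/-- The worst-case risk `sup_θ R_M(θ)`. -/
def worstRisk (ρ : QuantumModel Θ H) (w : Θ × U → ℝ≥0∞) (M : POVM U H) : ℝ≥0∞ :=
  ⨆ θ, risk ρ w M θ

/-- `M` is minimax in the class `C`: it minimizes the worst-case risk over `C`. -/
def IsMinimax (ρ : QuantumModel Θ H) (w : Θ × U → ℝ≥0∞) (C : Set (POVM U H))
    (M : POVM U H) : Prop :=
  M ∈ C ∧ ∀ N ∈ C, worstRisk ρ w M ≤ worstRisk ρ w N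

/-- `M` is Bayes in the class `C` with respect to `π`: it minimizes the average risk over `C`. -/
def IsBayes (ρ : QuantumModel Θ H) (w : Θ × U → ℝ≥0∞) (C : Set (POVM U H))
    (π : ProbabilityMeasure Θ) (M : POVM U H) : Prop :=
  M ∈ C ∧ ∀ N ∈ C, avgRisk ρ w M π ≤ avgRisk ρ w N π

/-- `π` is a least favorable prior for the class `C`: it attains
`sup_π inf_{M ∈ C} ∫ R_M(θ) π(dθ)`. -/
def IsLeastFavorable (ρ : QuantumModel Θ H) (w : Θ × U → ℝ≥0∞) (C : Set (POVM U H))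
    (π : ProbabilityMeasure Θ) : Prop :=
  (⨅ M ∈ C, avgRisk ρ w M π) = (⨆ π' : ProbabilityMeasure Θ, ⨅ M ∈ C, avgRisk ρ w M π')

end Decision

end

end QuantumDecision

open QuantumDecision

/-! For a continuous loss, regularity of the model makes every risk function continuous on the
compact space `Θ`, and convexity of the class makes the set of risk functions convex. If `V` is the
minimax value, no risk function lies in the open convex set of functions that are everywhere below
`V`. Hahn-Banach separates the two sets. The separating functional is positive and nonzero, so by
Riesz it is, up to scale, a prior, and every average risk under that prior is at least `V`. This is
`exists_worst_prior`; the reverse inequality is trivial, since an average never exceeds a supremum.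

The other claims rest on compactness of the space of POVMs. Along an ultrafilter the scalar measures
`⟨x, M(·) x⟩` have weak limits, and the point is to show that these come from a POVM. Setwise values
need not converge, but every linear relation between quadratic forms of positive operators is an
equality of finite measures, and such equalities survive weak limits; polarization then rebuilds the
operators (`POVM.exists_of_tendsto`).

The worst-case risk is lower semicontinuous in the POVM, so minimax POVMs exist. A lower
semicontinuous loss is an increasing limit of continuous ones, and nested compact sublevel sets
carry the equality over (`minimax_eq`). The equality forces a minimax POVM to be Bayes for every
least favorable prior, which settles the uniqueness claim. -/

namespace QuantumDecision

noncomputable section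

/-! ### Recovering a positive operator from its quadratic form -/

section Polarization

variable {H : Type*} [NormedAddCommGroup H] [InnerProductSpace ℂ H]

/-- The linear extension of a function on `H` to formal complex combinations of vectors. -/
def formalEval (q : H → ℝ) : (H →₀ ℂ) →ₗ[ℂ] ℂ :=
  Finsupp.linearCombination ℂ fun x => (q x : ℂ)

/-- The formal combination of vectors that occurs in the polarization identity. -/
def polar (y x : H) : H →₀ ℂ :=
  (1 / 4 : ℂ) • (Finsupp.single (x + y) 1 - Finsupp.single (x - y) 1
    + Finsupp.single (x + Complex.I • y) Complex.I
    - Finsupp.single (x - Complex.I • y) Complex.I)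

theorem formalEval_polar (q : H → ℝ) (y x : H) :
    formalEval q (polar y x) = ((q (x + y) : ℂ) - q (x - y) + Complex.I * q (x + Complex.I • y)
      - Complex.I * q (x - Complex.I • y)) / 4 := by
  simp only [formalEval, polar, map_smul, map_sub, map_add, Finsupp.linearCombination_single,
    smul_eq_mul]
  ring

theorem norm_formalEval_polar_le {q : H → ℝ} (hq : ∀ x, 0 ≤ q x) (hb : ∀ x, q x ≤ ‖x‖ ^ 2)
    (y x : H) : ‖formalEval q (polar y x)‖ ≤ (‖y‖ + ‖x‖) ^ 2 := by
  have hn : ∀ z : H, ‖z‖ ≤ ‖y‖ + ‖x‖ → ‖(q z : ℂ)‖ ≤ (‖y‖ + ‖x‖) ^ 2 := by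
    intro z hz
    rw [Complex.norm_real, Real.norm_of_nonneg (hq z)]
    exact (hb z).trans (pow_le_pow_left₀ (norm_nonneg _) hz 2)
  have hI : ‖Complex.I • y‖ = ‖y‖ := by simp [norm_smul]
  have h1 := hn (x + y) (by linarith [norm_add_le x y])
  have h2 := hn (x - y) (by linarith [norm_sub_le x y])
  have h3 := hn (x + Complex.I • y) (by linarith [norm_add_le x (Complex.I • y)])
  have h4 := hn (x - Complex.I • y) (by linarith [norm_sub_le x (Complex.I • y)])
  rw [formalEval_polar, norm_div]
  have e3 : ‖Complex.I * (q (x + Complex.I • y) : ℂ)‖ = ‖(q (x + Complex.I • y) : ℂ)‖ := by simp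
  have e4 : ‖Complex.I * (q (x - Complex.I • y) : ℂ)‖ = ‖(q (x - Complex.I • y) : ℂ)‖ := by simp
  have t1 := norm_sub_le ((q (x + y) : ℂ) - q (x - y) + Complex.I * q (x + Complex.I • y))
    (Complex.I * q (x - Complex.I • y))
  have t2 := norm_add_le ((q (x + y) : ℂ) - q (x - y)) (Complex.I * q (x + Complex.I • y))
  have t3 := norm_sub_le (q (x + y) : ℂ) (q (x - y))
  have : ‖(4 : ℂ)‖ = 4 := by simp
  rw [this]
  linarith

variable [CompleteSpace H]

/-- Through this identity, sesquilinearity of `⟨A y, x⟩` becomes a family of linear relations among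
values of the quadratic form. -/
theorem formalEval_polar_operator {A : H →L[ℂ] H} (hA : 0 ≤ A) (y x : H) :
    formalEval (fun z => (inner ℂ z (A z)).re) (polar y x) = inner ℂ (A y) x := by
  have hs : ∀ z, ((inner ℂ z (A z)).re : ℂ) = inner ℂ (A z) z := fun z => by
    rw [← inner_eq_re hA, ((ContinuousLinearMap.nonneg_iff_isPositive A).1
      hA).inner_left_eq_inner_right]
  rw [formalEval_polar]
  simp only [hs]
  exact (inner_map_polarization (A : H →ₗ[ℂ] H) x y).symm

/-- A bounded nonnegative function on `H` that satisfies all the linear relations satisfied by the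
quadratic forms of positive operators is itself the quadratic form of a positive operator. -/
theorem exists_operator_of_relations {q : H → ℝ} (hq : ∀ x, 0 ≤ q x) (hb : ∀ x, q x ≤ ‖x‖ ^ 2)
    (h : ∀ a : H →₀ ℂ, (∀ A : H →L[ℂ] H, 0 ≤ A →
      formalEval (fun z => (inner ℂ z (A z)).re) a = 0) → formalEval q a = 0) :
    ∃ A : H →L[ℂ] H, 0 ≤ A ∧ (∀ x, (inner ℂ x (A x)).re = q x) ∧
      ∀ y x, inner ℂ (A y) x = formalEval q (polar y x) := by
  have hadd₁ : ∀ y y' x, formalEval q (polar (y + y') x)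
      = formalEval q (polar y x) + formalEval q (polar y' x) := by
    intro y y' x
    have := h (polar (y + y') x - polar y x - polar y' x) fun A hA => by
      simp only [map_sub, formalEval_polar_operator hA, map_add, inner_add_left]; ring
    simp only [map_sub] at this
    linear_combination this
  have hsmul₁ : ∀ (c : ℂ) y x, formalEval q (polar (c • y) x)
      = starRingEnd ℂ c * formalEval q (polar y x) := by
    intro c y x
    have := h (polar (c • y) x - starRingEnd ℂ c • polar y x) fun A hA => by
      simp only [map_sub, map_smul, formalEval_polar_operator hA, inner_smul_left, smul_eq_mul,
        sub_self]
    simp only [map_sub, map_smul, smul_eq_mul] at this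
    linear_combination this
  have hadd₂ : ∀ y x x', formalEval q (polar y (x + x'))
      = formalEval q (polar y x) + formalEval q (polar y x') := by
    intro y x x'
    have := h (polar y (x + x') - polar y x - polar y x') fun A hA => by
      simp only [map_sub, formalEval_polar_operator hA, inner_add_right]; ring
    simp only [map_sub] at this
    linear_combination this
  have hsmul₂ : ∀ (c : ℂ) y x, formalEval q (polar y (c • x))
      = c * formalEval q (polar y x) := by
    intro c y x
    have := h (polar y (c • x) - c • polar y x) fun A hA => by
      simp only [map_sub, map_smul, formalEval_polar_operator hA, inner_smul_right, smul_eq_mul,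
        sub_self]
    simp only [map_sub, map_smul, smul_eq_mul] at this
    linear_combination this
  -- The crude bound `(‖y‖ + ‖x‖) ^ 2` is applied to unit vectors and rescaled by sesquilinearity;
  -- hence the constant `4 = (1 + 1) ^ 2`.
  have hbound : ∀ y x, ‖formalEval q (polar y x)‖ ≤ 4 * ‖y‖ * ‖x‖ := by
    intro y x
    rcases eq_or_ne y 0 with rfl | hy
    · have := hsmul₁ 0 0 x
      simp only [smul_zero, map_zero, zero_mul] at this
      simp [this]
    rcases eq_or_ne x 0 with rfl | hx
    · have := hsmul₂ 0 y 0
      simp only [smul_zero, zero_mul] at this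
      simp [this]
    have hy' := norm_pos_iff.2 hy
    have hx' := norm_pos_iff.2 hx
    have h1 := norm_formalEval_polar_le hq hb (((‖y‖⁻¹ : ℝ) : ℂ) • y) (((‖x‖⁻¹ : ℝ) : ℂ) • x)
    have n1 : ‖((‖y‖⁻¹ : ℝ) : ℂ) • y‖ = 1 := by
      rw [norm_smul, Complex.norm_real, norm_inv, norm_norm, inv_mul_cancel₀ hy'.ne']
    have n2 : ‖((‖x‖⁻¹ : ℝ) : ℂ) • x‖ = 1 := by
      rw [norm_smul, Complex.norm_real, norm_inv, norm_norm, inv_mul_cancel₀ hx'.ne']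
    rw [n1, n2, hsmul₁, hsmul₂, norm_mul, norm_mul, Complex.conj_ofReal, Complex.norm_real,
      Complex.norm_real, norm_inv, norm_inv, norm_norm, norm_norm] at h1
    calc ‖formalEval q (polar y x)‖
        = (‖y‖⁻¹ * (‖x‖⁻¹ * ‖formalEval q (polar y x)‖)) * (‖y‖ * ‖x‖) := by
          field_simp
      _ ≤ (1 + 1) ^ 2 * (‖y‖ * ‖x‖) := by gcongr
      _ = 4 * ‖y‖ * ‖x‖ := by ring
  let B₀ : H →ₗ⋆[ℂ] H →ₗ[ℂ] ℂ := LinearMap.mk₂'ₛₗ (starRingEnd ℂ) (RingHom.id ℂ)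
    (fun y x => formalEval q (polar y x)) hadd₁ hsmul₁ hadd₂ hsmul₂
  let B : H →L⋆[ℂ] H →L[ℂ] ℂ := B₀.mkContinuous₂ 4 hbound
  have hB : ∀ y x, inner ℂ (InnerProductSpace.continuousLinearMapOfBilin B y) x
      = formalEval q (polar y x) := fun y x =>
    InnerProductSpace.continuousLinearMapOfBilin_apply B y x
  have hdiag : ∀ x, formalEval q (polar x x) = q x := by
    intro x
    have := h (polar x x - Finsupp.single x 1) fun A hA => by
      rw [map_sub, formalEval_polar_operator hA]
      simp only [formalEval, Finsupp.linearCombination_single, one_smul]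
      rw [← inner_eq_re hA, ((ContinuousLinearMap.nonneg_iff_isPositive A).1
        hA).inner_left_eq_inner_right, sub_self]
    rw [map_sub, sub_eq_zero] at this
    rw [this]
    simp [formalEval]
  refine ⟨InnerProductSpace.continuousLinearMapOfBilin B, ?_, fun x => ?_, hB⟩
  · rw [ContinuousLinearMap.nonneg_iff_isPositive, ContinuousLinearMap.isPositive_iff_complex]
    intro x
    rw [hB, hdiag]
    exact ⟨by simp, by simpa using hq x⟩
  · rw [← inner_conj_symm, hB, hdiag]
    simp

end Polarization

/-! ### Signed linear relations between finite measures -/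

section FiniteMeasureRelations

variable {U ι : Type*} [MeasurableSpace U]

theorem finiteMeasure_sum_apply (s : Finset ι) (c : ι → ℝ≥0) (m : ι → FiniteMeasure U)
    (B : Set U) : (∑ x ∈ s, c x • m x) B = ∑ x ∈ s, c x * m x B := by
  induction s using Finset.cons_induction with
  | empty => simp
  | cons a s ha ih => rw [Finset.sum_cons, Finset.sum_cons, ← ih]; simp

theorem finiteMeasure_relation_iff (s : Finset ι) (c : ι → ℝ) (m : ι → FiniteMeasure U) :
    (∑ x ∈ s, (c x).toNNReal • m x = ∑ x ∈ s, (-c x).toNNReal • m x) ↔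
      ∀ B, MeasurableSet B → ∑ x ∈ s, c x * (m x B : ℝ) = 0 := by
  have key : ∀ B : Set U, ((∑ x ∈ s, (c x).toNNReal • m x) B = (∑ x ∈ s, (-c x).toNNReal • m x) B)
      ↔ ∑ x ∈ s, c x * (m x B : ℝ) = 0 := by
    intro B
    rw [finiteMeasure_sum_apply, finiteMeasure_sum_apply, ← NNReal.coe_inj, ← sub_eq_zero]
    push_cast
    rw [← Finset.sum_sub_distrib]
    refine Eq.congr (Finset.sum_congr rfl fun x _ => ?_) rfl
    rw [← sub_mul, Real.coe_toNNReal', Real.coe_toNNReal', max_zero_sub_max_neg_zero_eq_self]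
  constructor
  · intro h B _
    rw [← key, h]
  · intro h
    exact FiniteMeasure.eq_of_forall_apply_eq _ _ fun B hB => (key B).2 (h B hB)

end FiniteMeasureRelations

/-! ### Compactness of the space of POVMs -/

section Compactness

variable {U H : Type*} [MeasurableSpace U] [NormedAddCommGroup H] [InnerProductSpace ℂ H]
  [CompleteSpace H]

/-- The measure `B ↦ ⟨x, M(B) x⟩`. -/
def POVM.quadMeasure (M : POVM U H) (x : H) : Measure U :=
  Measure.ofMeasurable (fun B _ => ENNReal.ofReal (inner ℂ x (M.toFun B x)).re)
    (by simp [M.toFun_empty])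
    (by
      intro B hB hd
      have h := Complex.hasSum_re (M.hasSum_iUnion B hB hd x x)
      rw [← h.tsum_eq]
      exact ENNReal.ofReal_tsum_of_nonneg (fun j => inner_re_nonneg (M.nonneg _ (hB j)) _)
        h.summable)

theorem POVM.quadMeasure_apply (M : POVM U H) (x : H) {B : Set U} (hB : MeasurableSet B) :
    M.quadMeasure x B = ENNReal.ofReal (inner ℂ x (M.toFun B x)).re :=
  Measure.ofMeasurable_apply B hB

theorem POVM.quadMeasure_univ (M : POVM U H) (x : H) :
    M.quadMeasure x univ = ENNReal.ofReal (‖x‖ ^ 2) := by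
  rw [M.quadMeasure_apply x MeasurableSet.univ, M.univ_eq_one]
  congr 1
  exact inner_self_eq_norm_sq (𝕜 := ℂ) x

instance (M : POVM U H) (x : H) : IsFiniteMeasure (M.quadMeasure x) :=
  ⟨by rw [M.quadMeasure_univ]; exact ENNReal.ofReal_lt_top⟩

/-- `B ↦ ⟨x, M(B) x⟩` as a finite measure. -/
def POVM.quadFinite (M : POVM U H) (x : H) : FiniteMeasure U := ⟨M.quadMeasure x, inferInstance⟩

theorem POVM.quadFinite_apply (M : POVM U H) (x : H) {B : Set U} (hB : MeasurableSet B) :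
    (M.quadFinite x B : ℝ) = (inner ℂ x (M.toFun B x)).re := by
  change (M.quadMeasure x B).toReal = _
  rw [M.quadMeasure_apply x hB, ENNReal.toReal_ofReal (inner_re_nonneg (M.nonneg B hB) x)]

theorem POVM.quadFinite_mass (M : POVM U H) (x : H) : (M.quadFinite x).mass = ‖x‖₊ ^ 2 := by
  rw [← NNReal.coe_inj]
  change (M.quadMeasure x univ).toReal = _
  rw [M.quadMeasure_univ, ENNReal.toReal_ofReal (by positivity)]
  simp

/-- Reduces all questions about outcome distributions to the scalar measures of single vectors. -/
theorem POVM.bornMeasure_eq_sum (M : POVM U H) (T : H →L[ℂ] H) (hT : 0 ≤ T)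
    (hc : IsTraceClass T) :
    M.bornMeasure T hT hc = Measure.sum fun i => M.quadMeasure (CFC.sqrt T (stdBasis H i)) := by
  ext B hB
  rw [M.bornMeasure_apply T hT hc hB, ofReal_trace_mul hT hc (M.nonneg B hB),
    Measure.sum_apply _ hB]
  exact tsum_congr fun i => (M.quadMeasure_apply _ hB).symm

instance (M : POVM U H) (T : H →L[ℂ] H) (hT : 0 ≤ T) (hc : IsTraceClass T) :
    IsFiniteMeasure (M.bornMeasure T hT hc) :=
  ⟨by rw [M.bornMeasure_apply T hT hc MeasurableSet.univ]; exact ENNReal.ofReal_lt_top⟩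

variable [TopologicalSpace U]

theorem POVM.integral_bornMeasure [CompactSpace U] [OpensMeasurableSpace U] (M : POVM U H)
    (T : H →L[ℂ] H) (hT : 0 ≤ T) (hc : IsTraceClass T) (f : C(U, ℝ)) :
    ∫ u, f u ∂(M.bornMeasure T hT hc)
      = ∑' i, ∫ u, f u ∂(M.quadMeasure (CFC.sqrt T (stdBasis H i))) := by
  have hi : Integrable f (M.bornMeasure T hT hc) :=
    (BoundedContinuousFunction.mkOfCompact f).integrable _
  rw [M.bornMeasure_eq_sum] at hi ⊢
  exact (hasSum_integral_measure hi).tsum_eq.symm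

/-- Pointwise convergence of the measures `⟨x, M(·) x⟩` implies convergence of POVMs. -/
theorem POVM.tendsto_of_tendsto_quadFinite [CompactSpace U] [OpensMeasurableSpace U]
    {l : Filter (POVM U H)} {M : POVM U H}
    (h : ∀ x, Tendsto (fun N : POVM U H => N.quadFinite x) l (𝓝 (M.quadFinite x))) :
    l ≤ 𝓝 M := by
  rw [POVM.instTopologicalSpace]
  simp only [nhds_iInf, nhds_induced, le_iInf_iff]
  intro T hT hc f
  rw [← tendsto_iff_comap]
  simp only [POVM.integral_bornMeasure]
  -- Dominated convergence over the basis index: the mass of each quadratic measure is the squared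
  -- norm of its vector, so the bound does not depend on the POVM.
  refine tendsto_tsum_of_dominated_convergence
    (bound := fun i => ‖f‖ * ‖CFC.sqrt T (stdBasis H i)‖ ^ 2)
    ((summable_sqrt hT hc).mul_left _) (fun i => ?_) (Eventually.of_forall fun N i => ?_)
  · exact (FiniteMeasure.tendsto_iff_forall_integral_tendsto.1 (h (CFC.sqrt T (stdBasis H i))))
      (BoundedContinuousFunction.mkOfCompact f)
  · refine (norm_integral_le_of_norm_le_const (C := ‖f‖)
      (Eventually.of_forall fun u => f.norm_coe_le_norm u)).trans (le_of_eq ?_)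
    rw [Measure.real, N.quadMeasure_univ, ENNReal.toReal_ofReal (by positivity)]

variable [BorelSpace U] [HasOuterApproxClosed U]

/-- A limit of the quadratic measures of POVMs comes from a POVM. -/
theorem POVM.exists_of_tendsto {l : Filter (POVM U H)} [l.NeBot] {m : H → FiniteMeasure U}
    (h : ∀ x, Tendsto (fun N : POVM U H => N.quadFinite x) l (𝓝 (m x))) :
    ∃ M : POVM U H, ∀ x, M.quadFinite x = m x := by
  have hmass : ∀ x, (m x).mass = ‖x‖₊ ^ 2 := fun x =>
    tendsto_nhds_unique (h x).mass (by simp only [POVM.quadFinite_mass]; exact tendsto_const_nhds)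
  -- Weak convergence says nothing about a fixed `B`. Both sides of the relation are therefore
  -- passed to the limit as measures, and evaluated on `B` only afterwards.
  have hreal : ∀ (s : Finset H) (c : H → ℝ), (∀ A : H →L[ℂ] H, 0 ≤ A →
      ∑ x ∈ s, c x * (inner ℂ x (A x)).re = 0) →
      ∀ B, MeasurableSet B → ∑ x ∈ s, c x * (m x B : ℝ) = 0 := by
    intro s c hA
    rw [← finiteMeasure_relation_iff]
    refine tendsto_nhds_unique
      (tendsto_finsetSum s fun x _ => (h x).const_smul (c x).toNNReal) ?_
    have e : ∀ N : POVM U H, ∑ x ∈ s, (c x).toNNReal • N.quadFinite x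
        = ∑ x ∈ s, (-c x).toNNReal • N.quadFinite x := by
      intro N
      rw [finiteMeasure_relation_iff]
      intro B hB
      simp only [N.quadFinite_apply _ hB]
      exact hA _ (N.nonneg B hB)
    simp only [e]
    exact tendsto_finsetSum s fun x _ => (h x).const_smul (-c x).toNNReal
  -- A complex relation on a real function amounts to two real relations, to which `hreal` applies.
  have hform : ∀ (q : H → ℝ) (a : H →₀ ℂ), formalEval q a =
      ((∑ x ∈ a.support, (a x).re * q x : ℝ) : ℂ)
        + ((∑ x ∈ a.support, (a x).im * q x : ℝ) : ℂ) * Complex.I := by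
    intro q a
    rw [formalEval, Finsupp.linearCombination_apply, Finsupp.sum]
    push_cast
    rw [Finset.sum_mul, ← Finset.sum_add_distrib]
    refine Finset.sum_congr rfl fun x _ => ?_
    nth_rewrite 1 [← Complex.re_add_im (a x)]
    rw [smul_eq_mul]
    ring
  have hzero : ∀ (q : H → ℝ) (a : H →₀ ℂ), formalEval q a = 0 ↔
      ∑ x ∈ a.support, (a x).re * q x = 0 ∧ ∑ x ∈ a.support, (a x).im * q x = 0 := by
    intro q a
    rw [hform, Complex.ext_iff]
    simp
  have hop : ∀ B : Set U, MeasurableSet B → ∃ A : H →L[ℂ] H, 0 ≤ A ∧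
      (∀ x, (inner ℂ x (A x)).re = (m x B : ℝ)) ∧
      ∀ y x, inner ℂ (A y) x = formalEval (fun z => (m z B : ℝ)) (polar y x) := by
    intro B hB
    refine exists_operator_of_relations (fun x => NNReal.coe_nonneg _) (fun x => ?_)
      (fun a ha => ?_)
    · have : m x B ≤ ‖x‖₊ ^ 2 := hmass x ▸ (m x).apply_le_mass B
      exact_mod_cast this
    · rw [hzero]
      exact ⟨hreal _ _ (fun A hA => ((hzero _ _).1 (ha A hA)).1) B hB,
        hreal _ _ (fun A hA => ((hzero _ _).1 (ha A hA)).2) B hB⟩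
  classical
  choose! A hA hAq hAp using hop
  have hext : ∀ S T : H →L[ℂ] H, 0 ≤ S → 0 ≤ T →
      (∀ x, (inner ℂ x (S x)).re = (inner ℂ x (T x)).re) → S = T := by
    intro S T hS hT hST
    refine ContinuousLinearMap.ext fun y => ext_inner_right ℂ fun x => ?_
    rw [← formalEval_polar_operator hS, ← formalEval_polar_operator hT]
    simp only [hST]
  let M : POVM U H :=
    { toFun := fun B => if MeasurableSet B then A B else 0
      nonneg := fun B hB => by simpa only [if_pos hB] using hA B hB
      hasSum_iUnion := by
        intro B hB hd x y
        simp only [if_pos (hB _), if_pos (MeasurableSet.iUnion hB)]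
        have hs : ∀ z, HasSum (fun j => ((m z (B j) : ℝ) : ℂ)) ((m z (⋃ j, B j) : ℝ) : ℂ) := by
          intro z
          rw [Complex.hasSum_ofReal]
          have := ENNReal.hasSum_toReal (f := fun j => (m z : Measure U) (B j))
            (by rw [← measure_iUnion hd hB]; exact measure_ne_top _ _)
          rwa [← ENNReal.tsum_toReal_eq (fun j => measure_ne_top _ _), ← measure_iUnion hd hB]
            at this
        -- Off the diagonal, countable additivity is inherited from four scalar measures by
        -- polarization.
        have hc : HasSum (fun j => inner ℂ (A (B j) y) x) (inner ℂ (A (⋃ j, B j) y) x) := by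
          simp only [fun j => hAp (B j) (hB j) y x, hAp _ (MeasurableSet.iUnion hB) y x,
            formalEval_polar]
          exact ((((hs _).sub (hs _)).add ((hs _).mul_left _)).sub ((hs _).mul_left _)).div_const _
        have := Complex.hasSum_conj'.2 hc
        simpa only [inner_conj_symm] using this
      univ_eq_one := by
        simp only [if_pos MeasurableSet.univ]
        refine hext _ _ (hA _ MeasurableSet.univ) zero_le_one fun x => ?_
        rw [hAq _ MeasurableSet.univ]
        have h1 : (m x univ : ℝ) = ‖x‖ ^ 2 := by
          have := congrArg NNReal.toReal (hmass x)
          simpa [FiniteMeasure.mass] using this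
        rw [h1]
        exact (inner_self_eq_norm_sq (𝕜 := ℂ) x).symm
      eq_zero_of_not_measurable := fun B hB => by simp only [if_neg hB] }
  refine ⟨M, fun x => FiniteMeasure.eq_of_forall_apply_eq _ _ fun B hB => ?_⟩
  rw [← NNReal.coe_inj, M.quadFinite_apply x hB, ← hAq B hB]
  simp only [M, if_pos hB]

/-- The POVMs on a compact space form a compact space. -/
instance [T2Space U] [CompactSpace U] : CompactSpace (POVM U H) := by
  refine ⟨isCompact_iff_ultrafilter_le_nhds.2 fun l _ => ?_⟩
  have hlim : ∀ x, ∃ μ : FiniteMeasure U,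
      Tendsto (fun N : POVM U H => N.quadFinite x) l (𝓝 μ) := by
    intro x
    -- The measures of fixed mass `‖x‖ ^ 2` on a compact space form a weakly compact set.
    obtain ⟨μ, -, hμ⟩ := isCompact_iff_ultrafilter_le_nhds.1
      (isCompact_setOfPred_finiteMeasure_eq_of_compactSpace U (‖x‖₊ ^ 2))
      (l.map fun N => N.quadFinite x) (by
        rw [le_principal_iff]
        exact Filter.univ_mem' (f := (l : Filter (POVM U H))) fun N => N.quadFinite_mass x)
    exact ⟨μ, hμ⟩
  choose m hm using hlim
  obtain ⟨M, hM⟩ := POVM.exists_of_tendsto hm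
  refine ⟨M, mem_univ _, POVM.tendsto_of_tendsto_quadFinite fun x => ?_⟩
  rw [hM]
  exact hm x

end Compactness

/-! ### Operator inequalities and outcome distributions -/

section TraceInequality

variable {H : Type*} [NormedAddCommGroup H] [InnerProductSpace ℂ H] [CompleteSpace H]

theorem summable_adjoint (B : H →L[ℂ] H) (h : Summable fun i => ‖B (stdBasis H i)‖ ^ 2) :
    Summable fun i => ‖ContinuousLinearMap.adjoint B (stdBasis H i)‖ ^ 2 := by
  refine (summable_matrix B h).prod_symm.prod.congr fun i => ?_
  rw [← tsum_basis_sq]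
  refine tsum_congr fun j => ?_
  rw [ContinuousLinearMap.adjoint_inner_left, ← inner_conj_symm, RCLike.norm_conj]
  rfl

/-- Each term pairs `√T eᵢ` with `√T A eᵢ`, and both sequences are square summable because `√T A` is
the adjoint of the Hilbert-Schmidt operator `A* √T`. Without summability the `tsum` defining `trace`
could not be split. -/
theorem summable_trace_mul {T : H →L[ℂ] H} (hT : 0 ≤ T) (hc : IsTraceClass T) (A : H →L[ℂ] H) :
    Summable fun i => inner ℂ (stdBasis H i) ((T * A) (stdBasis H i)) := by
  have hsum := summable_sqrt hT hc
  have h2 : Summable fun i => ‖CFC.sqrt T (A (stdBasis H i))‖ ^ 2 := by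
    have h := summable_adjoint _ (summable_comp (ContinuousLinearMap.adjoint A) (CFC.sqrt T) hsum)
    refine h.congr fun i => ?_
    congr 2
    refine ext_inner_right ℂ fun y => ?_
    rw [ContinuousLinearMap.adjoint_inner_left, sqrt_inner]
    exact (ContinuousLinearMap.adjoint_inner_right A _ _)
  refine Summable.of_norm_bounded (hsum.add h2) fun i => ?_
  have e : inner ℂ (stdBasis H i) ((T * A) (stdBasis H i))
      = inner ℂ (CFC.sqrt T (stdBasis H i)) (CFC.sqrt T (A (stdBasis H i))) := by
    conv_lhs => rw [← CFC.sqrt_mul_sqrt_self T hT]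
    exact (sqrt_inner T _ _).symm
  rw [e]
  refine (norm_inner_le_norm _ _).trans ?_
  nlinarith [sq_nonneg (‖CFC.sqrt T (stdBasis H i)‖ - ‖CFC.sqrt T (A (stdBasis H i))‖),
    sq_nonneg ‖CFC.sqrt T (stdBasis H i)‖, sq_nonneg ‖CFC.sqrt T (A (stdBasis H i))‖]

theorem traceNorm_of_nonneg {T : H →L[ℂ] H} (hT : 0 ≤ T) :
    traceNorm T = ∑' i, ENNReal.ofReal (inner ℂ (stdBasis H i) (T (stdBasis H i))).re := by
  rw [traceNorm, CFC.abs_of_nonneg T hT]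

/-- The operator `T' + X - T` is positive and trace class, so its product with the positive operator
`A` has nonnegative trace. -/
theorem trace_mul_re_le {T T' X A : H →L[ℂ] H} (hT : 0 ≤ T) (hc : IsTraceClass T)
    (hT' : 0 ≤ T') (hc' : IsTraceClass T') (hX : 0 ≤ X) (hcX : IsTraceClass X)
    (hle : T - T' ≤ X) (hA : 0 ≤ A) :
    (trace (T * A)).re ≤ (trace (T' * A)).re + (trace (X * A)).re := by
  have hD : 0 ≤ T' + X - T := by
    have := sub_nonneg.2 hle
    rwa [show X - (T - T') = T' + X - T by abel] at this
  have hcD : IsTraceClass (T' + X - T) := by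
    have hb : traceNorm (T' + X - T) ≤ traceNorm T' + traceNorm X := by
      rw [traceNorm_of_nonneg hD, traceNorm_of_nonneg hT', traceNorm_of_nonneg hX,
        ← ENNReal.tsum_add]
      refine ENNReal.tsum_le_tsum fun i => ?_
      rw [← ENNReal.ofReal_add (inner_re_nonneg hT' _) (inner_re_nonneg hX _)]
      refine ENNReal.ofReal_le_ofReal ?_
      have := inner_re_nonneg hT (stdBasis H i)
      simp only [sub_apply, add_apply, inner_sub_right,
        inner_add_right, Complex.sub_re, Complex.add_re]
      linarith
    exact ne_top_of_le_ne_top (ENNReal.add_ne_top.2 ⟨hc', hcX⟩) hb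
  have e : trace ((T' + X - T) * A) = trace (T' * A) + trace (X * A) - trace (T * A) := by
    have s1 := summable_trace_mul hT' hc' A
    have s2 := summable_trace_mul hX hcX A
    have s3 := summable_trace_mul hT hc A
    rw [trace, trace, trace, trace, ← s1.tsum_add s2, ← (s1.add s2).tsum_sub s3]
    refine tsum_congr fun i => ?_
    rw [sub_mul, add_mul, sub_apply, add_apply,
      inner_sub_right, inner_add_right]
  have h0 : 0 ≤ (trace ((T' + X - T) * A)).re := by
    rw [trace_mul_eq_ofReal hD hcD hA, Complex.ofReal_re]
    exact tsum_nonneg fun i => inner_re_nonneg hA _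
  rw [e, Complex.sub_re, Complex.add_re] at h0
  linarith

variable {U : Type*} [MeasurableSpace U]

theorem POVM.bornMeasure_le (M : POVM U H) {T T' X : H →L[ℂ] H} (hT : 0 ≤ T)
    (hc : IsTraceClass T) (hT' : 0 ≤ T') (hc' : IsTraceClass T') (hX : 0 ≤ X)
    (hcX : IsTraceClass X) (hle : T - T' ≤ X) :
    M.bornMeasure T hT hc ≤ M.bornMeasure T' hT' hc' + M.bornMeasure X hX hcX := by
  refine Measure.le_iff.2 fun B hB => ?_
  rw [Measure.add_apply, M.bornMeasure_apply _ _ _ hB, M.bornMeasure_apply _ _ _ hB,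
    M.bornMeasure_apply _ _ _ hB]
  exact (ENNReal.ofReal_le_ofReal
    (trace_mul_re_le hT hc hT' hc' hX hcX hle (M.nonneg B hB))).trans ENNReal.ofReal_add_le

theorem POVM.bornMeasure_univ (M : POVM U H) (T : H →L[ℂ] H) (hT : 0 ≤ T)
    (hc : IsTraceClass T) : M.bornMeasure T hT hc univ = traceNorm T := by
  rw [M.bornMeasure_apply _ _ _ MeasurableSet.univ,
    ofReal_trace_mul hT hc (M.nonneg _ MeasurableSet.univ), M.univ_eq_one, traceNorm_of_nonneg hT]
  refine tsum_congr fun i => ?_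
  conv_rhs => rw [← CFC.sqrt_mul_sqrt_self T hT]
  rw [mul_apply_eq_comp, ← sqrt_inner]
  rfl

theorem POVM.bornMeasure_mixture {L M N : POVM U H} {t : ℝ} (h0 : 0 ≤ t) (h1 : t ≤ 1)
    (h : ∀ B, L.toFun B = (t : ℂ) • M.toFun B + ((1 - t : ℝ) : ℂ) • N.toFun B)
    (T : H →L[ℂ] H) (hT : 0 ≤ T) (hc : IsTraceClass T) :
    L.bornMeasure T hT hc = ENNReal.ofReal t • M.bornMeasure T hT hc
      + ENNReal.ofReal (1 - t) • N.bornMeasure T hT hc := by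
  ext B hB
  rw [Measure.add_apply, Measure.smul_apply, Measure.smul_apply, L.bornMeasure_apply _ _ _ hB,
    M.bornMeasure_apply _ _ _ hB, N.bornMeasure_apply _ _ _ hB,
    ofReal_trace_mul hT hc (L.nonneg B hB), ofReal_trace_mul hT hc (M.nonneg B hB),
    ofReal_trace_mul hT hc (N.nonneg B hB), smul_eq_mul, smul_eq_mul, ← ENNReal.tsum_mul_left,
    ← ENNReal.tsum_mul_left, ← ENNReal.tsum_add]
  refine tsum_congr fun i => ?_
  have hM := inner_re_nonneg (M.nonneg B hB) (CFC.sqrt T (stdBasis H i))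
  have hN := inner_re_nonneg (N.nonneg B hB) (CFC.sqrt T (stdBasis H i))
  rw [← ENNReal.ofReal_mul h0, ← ENNReal.ofReal_mul (sub_nonneg.2 h1),
    ← ENNReal.ofReal_add (mul_nonneg h0 hM) (mul_nonneg (sub_nonneg.2 h1) hN), h B]
  simp only [add_apply, smul_apply, inner_add_right,
    inner_smul_right, Complex.add_re, Complex.re_ofReal_mul]

end TraceInequality

/-! ### Continuity of the risk in the parameter -/

section RiskContinuity

variable {Θ U H : Type*} [MetricSpace Θ] [MeasurableSpace U]
  [NormedAddCommGroup H] [InnerProductSpace ℂ H] [CompleteSpace H]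

theorem QuantumModel.traceNorm_state (ρ : QuantumModel Θ H) (θ : Θ) :
    traceNorm (ρ.state θ) = 1 := by
  have h := ofReal_trace_mul (ρ.nonneg θ) (ρ.traceClass θ) (zero_le_one (α := H →L[ℂ] H))
  rw [mul_one, ρ.trace_eq_one, Complex.one_re, ENNReal.ofReal_one] at h
  rw [h, traceNorm_of_nonneg (ρ.nonneg θ)]
  refine tsum_congr fun i => ?_
  conv_lhs => rw [← CFC.sqrt_mul_sqrt_self _ (ρ.nonneg θ)]
  rw [mul_apply_eq_comp, ← sqrt_inner]
  rfl

theorem risk_le_of_le (ρ : QuantumModel Θ H) {w : Θ × U → ℝ≥0∞} {c : ℝ≥0∞} (hw : ∀ p, w p ≤ c)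
    (M : POVM U H) (θ : Θ) : risk ρ w M θ ≤ c := by
  refine (lintegral_mono fun u => hw (θ, u)).trans ?_
  rw [lintegral_const, M.bornMeasure_univ, ρ.traceNorm_state, mul_one]

theorem risk_mixture (ρ : QuantumModel Θ H) (w : Θ × U → ℝ≥0∞) {L M N : POVM U H} {t : ℝ}
    (h0 : 0 ≤ t) (h1 : t ≤ 1)
    (h : ∀ B, L.toFun B = (t : ℂ) • M.toFun B + ((1 - t : ℝ) : ℂ) • N.toFun B) (θ : Θ) :
    risk ρ w L θ = ENNReal.ofReal t * risk ρ w M θ + ENNReal.ofReal (1 - t) * risk ρ w N θ := by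
  rw [risk, risk, risk, POVM.bornMeasure_mixture h0 h1 h, lintegral_add_measure,
    lintegral_smul_measure, lintegral_smul_measure, smul_eq_mul, smul_eq_mul]

variable [CompactSpace Θ] [MetricSpace U] [CompactSpace U]

theorem exists_bound_of_continuous {X : Type*} [TopologicalSpace X] [CompactSpace X]
    {v : X → ℝ≥0} (hv : Continuous v) : ∃ c : ℝ≥0, ∀ p, v p ≤ c := by
  obtain ⟨c, hc⟩ := (isCompact_range hv).bddAbove
  exact ⟨c, fun p => hc (mem_range_self p)⟩

/-- Moving from `η` to `θ` costs two errors: the loss changes uniformly little, and the outcome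
distribution grows by at most a measure of mass `‖X‖₁`, which regularity makes small. -/
theorem exists_dist_risk_le (ρ : QuantumModel Θ H) {v : Θ × U → ℝ≥0} (hv : Continuous v)
    (M : POVM U H) {ε : ℝ≥0} (hε : 0 < ε) :
    ∃ δ > 0, ∀ θ η : Θ, dist θ η < δ →
      risk ρ (fun p => (v p : ℝ≥0∞)) M θ ≤ risk ρ (fun p => (v p : ℝ≥0∞)) M η + ε := by
  obtain ⟨c, hc⟩ := exists_bound_of_continuous hv
  -- The loss contributes `e` and the change of state at most `c * e`; together they make `ε`.
  set e : ℝ≥0 := ε / (1 + c) with he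
  have hepos : 0 < e := by positivity
  have hsum : e + c * e = ε := by
    rw [he]; field_simp
  obtain ⟨δ₁, hδ₁, h₁⟩ := Metric.uniformContinuous_iff.1
    (CompactSpace.uniformContinuous_of_continuous hv) e (by exact_mod_cast hepos)
  have hmod := (ρ.regular univ isCompact_univ).eventually_lt_const
    (show (0 : ℝ≥0∞) < e by exact_mod_cast hepos)
  obtain ⟨δ, hδm, hδ0, hδ1⟩ := (hmod.and (Ioo_mem_nhdsGT hδ₁)).exists
  rw [modulus] at hδm
  simp only [iInf_lt_iff] at hδm
  obtain ⟨X, hcX, hX, hXe⟩ := hδm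
  refine ⟨δ, hδ0, fun θ η hd => ?_⟩
  -- Positivity of `X` is the case of equal parameters.
  have hX0 : 0 ≤ X := by
    simpa using (hX θ (mem_univ _) θ (mem_univ _) (by simpa using hδ0)).2
  have hmeas := M.bornMeasure_le (ρ.nonneg θ) (ρ.traceClass θ) (ρ.nonneg η) (ρ.traceClass η)
    hX0 hcX (hX θ (mem_univ _) η (mem_univ _) hd).2
  calc risk ρ (fun p => (v p : ℝ≥0∞)) M θ
      ≤ ∫⁻ u, ((v (η, u) : ℝ≥0∞) + e)
          ∂(M.bornMeasure (ρ.state θ) (ρ.nonneg θ) (ρ.traceClass θ)) := by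
        refine lintegral_mono fun u => ?_
        have hd' : dist (θ, u) (η, u) < δ₁ := by
          rw [Prod.dist_eq, dist_self]
          exact max_lt (hd.trans hδ1) hδ₁
        have := h₁ hd'
        rw [NNReal.dist_eq] at this
        have h2 : (v (θ, u) : ℝ) ≤ v (η, u) + e := by linarith [(abs_lt.1 this).2]
        have h3 : v (θ, u) ≤ v (η, u) + e := by exact_mod_cast h2
        change (v (θ, u) : ℝ≥0∞) ≤ v (η, u) + e
        exact_mod_cast h3
    _ = (∫⁻ u, (v (η, u) : ℝ≥0∞)
          ∂(M.bornMeasure (ρ.state θ) (ρ.nonneg θ) (ρ.traceClass θ))) + e := by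
        rw [lintegral_add_right _ measurable_const, lintegral_const, M.bornMeasure_univ,
          ρ.traceNorm_state, mul_one]
    _ ≤ (risk ρ (fun p => (v p : ℝ≥0∞)) M η
          + ∫⁻ u, (v (η, u) : ℝ≥0∞) ∂(M.bornMeasure X hX0 hcX)) + e := by
        gcongr
        refine (lintegral_mono' hmeas le_rfl).trans ?_
        rw [lintegral_add_measure]
        rfl
    _ ≤ (risk ρ (fun p => (v p : ℝ≥0∞)) M η + c * e) + e := by
        gcongr
        refine (lintegral_mono fun u => ENNReal.coe_le_coe.2 (hc (η, u))).trans ?_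
        rw [lintegral_const, M.bornMeasure_univ]
        gcongr
    _ = risk ρ (fun p => (v p : ℝ≥0∞)) M η + ε := by
        rw [add_assoc, add_comm (_ * _), ← hsum]
        push_cast
        rfl

theorem continuous_risk (ρ : QuantumModel Θ H) {v : Θ × U → ℝ≥0} (hv : Continuous v)
    (M : POVM U H) : Continuous (risk ρ (fun p => (v p : ℝ≥0∞)) M) := by
  obtain ⟨c, hc⟩ := exists_bound_of_continuous hv
  refine continuous_iff_continuousAt.2 fun θ => ?_
  have hfin : risk ρ (fun p => (v p : ℝ≥0∞)) M θ ≠ ∞ :=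
    ne_top_of_le_ne_top ENNReal.coe_ne_top
      (risk_le_of_le ρ (fun p => ENNReal.coe_le_coe.2 (hc p)) M θ)
  refine (ENNReal.tendsto_nhds hfin).2 fun ε hε => ?_
  obtain ⟨e, he, heε⟩ := ENNReal.lt_iff_exists_nnreal_btwn.1 hε
  obtain ⟨δ, hδ, h⟩ := exists_dist_risk_le ρ hv M (ENNReal.coe_pos.1 he)
  filter_upwards [Metric.ball_mem_nhds θ hδ] with η hη
  rw [mem_Icc, tsub_le_iff_right]
  exact ⟨(h θ η (by rwa [dist_comm])).trans (by gcongr), (h η θ hη).trans (by gcongr)⟩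

/-- The risk function for a continuous loss, as a continuous real function. -/
def riskMap (ρ : QuantumModel Θ H) (v : Θ × U → ℝ≥0) (hv : Continuous v) (M : POVM U H) :
    C(Θ, ℝ) where
  toFun θ := (risk ρ (fun p => (v p : ℝ≥0∞)) M θ).toReal
  continuous_toFun := by
    obtain ⟨c, hc⟩ := exists_bound_of_continuous hv
    exact ENNReal.continuousOn_toReal.comp_continuous (continuous_risk ρ hv M) fun θ =>
      ne_top_of_le_ne_top ENNReal.coe_ne_top
        (risk_le_of_le ρ (fun p => ENNReal.coe_le_coe.2 (hc p)) M θ)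

theorem ofReal_riskMap (ρ : QuantumModel Θ H) {v : Θ × U → ℝ≥0} (hv : Continuous v)
    (M : POVM U H) (θ : Θ) :
    ENNReal.ofReal (riskMap ρ v hv M θ) = risk ρ (fun p => (v p : ℝ≥0∞)) M θ := by
  obtain ⟨c, hc⟩ := exists_bound_of_continuous hv
  exact ENNReal.ofReal_toReal (ne_top_of_le_ne_top ENNReal.coe_ne_top
    (risk_le_of_le ρ (fun p => ENNReal.coe_le_coe.2 (hc p)) M θ))

end RiskContinuity

/-! ### Dependence of the risk on the POVM -/

section RiskSemicontinuity

variable {Θ U H : Type*} [MetricSpace Θ] [MetricSpace U] [CompactSpace U] [MeasurableSpace U]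
  [BorelSpace U] [NormedAddCommGroup H] [InnerProductSpace ℂ H] [CompleteSpace H]

theorem continuous_risk_povm (ρ : QuantumModel Θ H) {v : Θ × U → ℝ≥0} (hv : Continuous v)
    (θ : Θ) : Continuous fun M : POVM U H => risk ρ (fun p => (v p : ℝ≥0∞)) M θ := by
  let f : C(U, ℝ) := ⟨fun u => (v (θ, u) : ℝ), by fun_prop⟩
  have hf : Continuous fun M : POVM U H =>
      ∫ u, f u ∂(M.bornMeasure (ρ.state θ) (ρ.nonneg θ) (ρ.traceClass θ)) :=
    continuous_iInf_dom (i := ρ.state θ) <| continuous_iInf_dom (i := ρ.nonneg θ) <|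
      continuous_iInf_dom (i := ρ.traceClass θ) <| continuous_iInf_dom (i := f)
        continuous_induced_dom
  convert ENNReal.continuous_ofReal.comp hf using 2 with M
  rw [Function.comp_apply, ofReal_integral_eq_lintegral_ofReal
    (f := f) ((BoundedContinuousFunction.mkOfCompact f).integrable _)
    (Eventually.of_forall fun u => NNReal.coe_nonneg _)]
  exact lintegral_congr fun u => (ENNReal.ofReal_coe_nnreal).symm

theorem lowerSemicontinuous_worstRisk_of_continuous (ρ : QuantumModel Θ H) {v : Θ × U → ℝ≥0}
    (hv : Continuous v) :
    LowerSemicontinuous fun M : POVM U H => worstRisk ρ (fun p => (v p : ℝ≥0∞)) M :=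
  lowerSemicontinuous_iSup fun θ => (continuous_risk_povm ρ hv θ).lowerSemicontinuous

end RiskSemicontinuity

/-! ### Priors from Hahn-Banach and Riesz -/

section Separation

variable {Θ : Type*} [TopologicalSpace Θ] [CompactSpace Θ] [T2Space Θ]
  [MeasurableSpace Θ] [BorelSpace Θ]

/-- A normalized positive functional on `C(Θ)` is the integral of a probability measure. -/
theorem exists_probabilityMeasure_of_functional (f : C(Θ, ℝ) →ₗ[ℝ] ℝ)
    (hpos : ∀ g : C(Θ, ℝ), 0 ≤ g → 0 ≤ f g) (hone : f 1 = 1) :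
    ∃ π : ProbabilityMeasure Θ, ∀ g : C(Θ, ℝ), ∫ θ, g θ ∂(π : Measure Θ) = f g := by
  let Λ : CompactlySupportedContinuousMap Θ ℝ →ₚ[ℝ] ℝ :=
    { toFun := fun g => f g.toContinuousMap
      map_add' := fun g g' => f.map_add _ _
      map_smul' := fun c g => f.map_smul _ _
      monotone' := fun g g' hgg' => by
        have := hpos (g'.toContinuousMap - g.toContinuousMap) fun θ => sub_nonneg.2 (hgg' θ)
        rwa [map_sub, sub_nonneg] at this }
  have hint : ∀ g : C(Θ, ℝ), ∫ θ, g θ ∂(RealRMK.rieszMeasure Λ) = f g := fun g =>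
    RealRMK.integral_rieszMeasure Λ ⟨g, HasCompactSupport.of_compactSpace _⟩
  have h1 := hint 1
  simp only [ContinuousMap.one_apply, integral_const, smul_eq_mul, mul_one, hone] at h1
  have hprob : IsProbabilityMeasure (RealRMK.rieszMeasure Λ) :=
    ⟨by rwa [← ENNReal.toReal_eq_one_iff]⟩
  exact ⟨⟨RealRMK.rieszMeasure Λ, hprob⟩, hint⟩

/-- If every member of a convex family of continuous functions exceeds `V` somewhere, then a single
probability measure gives all of them an integral at least `V`. -/
theorem exists_probabilityMeasure_le_integral [Nonempty Θ] {R : Set C(Θ, ℝ)} (hR : Convex ℝ R) {V : ℝ}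
    (h : ∀ r ∈ R, ∃ θ, V ≤ r θ) :
    ∃ π : ProbabilityMeasure Θ, ∀ r ∈ R, V ≤ ∫ θ, r θ ∂(π : Measure Θ) := by
  rcases R.eq_empty_or_nonempty with rfl | ⟨r₀, hr₀⟩
  · exact ⟨⟨Measure.dirac (Classical.arbitrary Θ), inferInstance⟩, by simp⟩
  let A : Set C(Θ, ℝ) := {g | ∀ θ, g θ < V}
  have hAconv : Convex ℝ A := by
    intro g hg g' hg' a b ha hb hab θ
    have h1 := hg θ
    have h2 := hg' θ
    simp only [ContinuousMap.add_apply, ContinuousMap.smul_apply, smul_eq_mul]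
    rcases ha.eq_or_lt with rfl | ha
    · rw [zero_add] at hab; subst hab; simpa using h2
    · have : a * g θ + b * g' θ < a * V + b * V :=
        add_lt_add_of_lt_of_le (mul_lt_mul_of_pos_left h1 ha)
          (mul_le_mul_of_nonneg_left h2.le hb)
      rwa [← add_mul, hab, one_mul] at this
  have hAopen : IsOpen A := by
    have := ContinuousMap.isOpen_setOfPred_mapsTo (X := Θ) (Y := ℝ) isCompact_univ
      (isOpen_Iio (a := V))
    convert this using 1
    ext g
    simp [A, MapsTo]
  have hdisj : Disjoint A R := by
    rw [Set.disjoint_left]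
    intro g hg hgR
    obtain ⟨θ, hθ⟩ := h g hgR
    exact absurd (hg θ) hθ.not_gt
  obtain ⟨f, u, hfA, hfR⟩ := geometric_hahn_banach_open hAconv hAopen hR hdisj
  have hconst : ∀ c : ℝ, f (ContinuousMap.const Θ c) = c * f 1 := by
    intro c
    rw [← smul_eq_mul, ← map_smul]
    congr 1
    ext θ
    simp
  have hpos : ∀ g : C(Θ, ℝ), 0 ≤ g → 0 ≤ f g := by
    intro g hg
    by_contra! hlt
    -- If `f g < 0`, the functions `V - 1 - n g` stay in `A` while their images under `f` grow
    -- without bound; this `n` already reaches `u`.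
    obtain ⟨n, hn⟩ := exists_nat_ge ((u - (V - 1) * f 1) / (-f g))
    have hmem : ContinuousMap.const Θ (V - 1) - (n : ℝ) • g ∈ A := by
      intro θ
      have h1 : 0 ≤ (n : ℝ) * g θ := mul_nonneg n.cast_nonneg (hg θ)
      simp only [ContinuousMap.sub_apply, ContinuousMap.const_apply, ContinuousMap.smul_apply,
        smul_eq_mul]
      linarith
    have h2 := hfA _ hmem
    rw [map_sub, map_smul, hconst, smul_eq_mul] at h2
    rw [div_le_iff₀ (by linarith)] at hn
    linarith
  have hone : 0 < f 1 := by
    -- A positive functional that vanishes at `1` is zero, which contradicts the strict separation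
    -- of `V - 1` from `r₀`.
    refine lt_of_le_of_ne (hpos 1 fun θ => zero_le_one) fun h0 => ?_
    have hzero : ∀ g : C(Θ, ℝ), 0 ≤ f g := by
      intro g
      have h1 := hpos (ContinuousMap.const Θ ‖g‖ + g) fun θ => by
        have := (abs_le.1 (g.norm_coe_le_norm θ)).1
        change 0 ≤ ‖g‖ + g θ
        linarith
      rwa [map_add, hconst, ← h0, mul_zero, zero_add] at h1
    have hz : ∀ g : C(Θ, ℝ), f g = 0 := fun g => le_antisymm
      (by have := hzero (-g); rw [map_neg] at this; linarith) (hzero g)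
    have h1 := hfA (ContinuousMap.const Θ (V - 1)) fun θ => by simp
    have h2 := hfR r₀ hr₀
    rw [hz] at h1 h2
    linarith
  have hVu : V * f 1 ≤ u := by
    by_contra! hlt
    -- This constant is chosen so that `f` takes the value `u` on it, whereas `f < u` on `A`.
    have hmem : ContinuousMap.const Θ (u / f 1) ∈ A := fun θ => by
      simpa [div_lt_iff₀ hone] using hlt
    have := hfA _ hmem
    rw [hconst, div_mul_cancel₀ _ hone.ne'] at this
    exact lt_irrefl _ this
  obtain ⟨π, hπ⟩ := exists_probabilityMeasure_of_functional
    ((f 1)⁻¹ • (f : C(Θ, ℝ) →ₗ[ℝ] ℝ))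
    (fun g hg => mul_nonneg (inv_nonneg.2 hone.le) (hpos g hg)) (inv_mul_cancel₀ hone.ne')
  refine ⟨π, fun r hr => ?_⟩
  rw [hπ]
  change V ≤ (f 1)⁻¹ * f r
  rw [inv_mul_eq_div, le_div_iff₀ hone]
  exact hVu.trans (hfR r hr)

end Separation

/-! ### Lipschitz regularization of the loss -/

section Approximation

variable {X : Type*} [PseudoMetricSpace X]

/-- The `n`-th Lipschitz regularization of `w`, truncated at `n`. -/
def lipApprox (w : X → ℝ≥0∞) (n : ℕ) (p : X) : ℝ≥0∞ :=
  min (n : ℝ≥0∞) (⨅ q, w q + n * edist p q)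

theorem lipApprox_lt_top (w : X → ℝ≥0∞) (n : ℕ) (p : X) : lipApprox w n p < ∞ :=
  (min_le_left _ _).trans_lt (ENNReal.natCast_lt_top n)

theorem lipApprox_le (w : X → ℝ≥0∞) (n : ℕ) (p : X) : lipApprox w n p ≤ w p :=
  (min_le_right _ _).trans ((iInf_le _ p).trans (by simp))

theorem continuous_lipApprox (w : X → ℝ≥0∞) (n : ℕ) : Continuous (lipApprox w n) := by
  refine continuous_const.min
    (continuous_of_le_add_edist n (ENNReal.natCast_ne_top n) fun x y => ?_)
  rw [ENNReal.iInf_add]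
  refine le_iInf fun q => (iInf_le _ q).trans ?_
  rw [add_assoc, ← mul_add, add_comm (edist y q)]
  gcongr
  exact edist_triangle x y q

theorem lipApprox_mono (w : X → ℝ≥0∞) (p : X) : Monotone fun n => lipApprox w n p := by
  intro m n hmn
  refine min_le_min (by exact_mod_cast hmn) (iInf_mono fun q => ?_)
  gcongr

/-- For `b < w p`, semicontinuity keeps `w` above `b` on a ball around `p`, and outside the ball the
penalty `n * edist p q` exceeds `b` once `n` is large. -/
theorem iSup_lipApprox {w : X → ℝ≥0∞} (hw : LowerSemicontinuous w) (p : X) :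
    ⨆ n, lipApprox w n p = w p := by
  refine le_antisymm (iSup_le fun n => lipApprox_le w n p) (le_of_forall_lt fun c hc => ?_)
  obtain ⟨b, hcb, hb⟩ := exists_between hc
  have hbt : b ≠ ∞ := hb.ne_top
  obtain ⟨δ, hδ, hball⟩ := EMetric.mem_nhds_iff.1 (hw p b hb)
  -- The summand `b` takes care of the truncation at `n`, the summand `b / δ` of the points outside
  -- the ball.
  obtain ⟨n, hn⟩ := ENNReal.exists_nat_gt (ENNReal.add_ne_top.2
    ⟨hbt, ENNReal.div_ne_top hbt hδ.ne'⟩)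
  have hn1 : b ≤ n := le_self_add.trans hn.le
  have hn0 : (n : ℝ≥0∞) ≠ 0 := (zero_le.trans_lt hn).ne'
  have hn2 : b ≤ n * δ :=
    (ENNReal.div_le_iff_le_mul (Or.inl hδ.ne') (Or.inr hn0)).1 (le_add_self.trans hn.le)
  refine hcb.trans_le (le_iSup_of_le n (le_min hn1 (le_iInf fun q => ?_)))
  by_cases hq : q ∈ Metric.eball p δ
  · exact (le_of_lt (hball hq)).trans le_self_add
  · rw [Metric.mem_eball, not_lt, edist_comm] at hq
    exact (hn2.trans (by gcongr)).trans le_add_self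

/-- A lower semicontinuous function with values in `[0, ∞]` is the supremum of an increasing sequence
of continuous finite functions. -/
theorem exists_monotone_continuous_iSup_eq {w : X → ℝ≥0∞} (hw : LowerSemicontinuous w) :
    ∃ v : ℕ → X → ℝ≥0, (∀ n, Continuous (v n)) ∧ (∀ p, Monotone fun n => (v n p : ℝ≥0∞)) ∧
      ∀ p, ⨆ n, (v n p : ℝ≥0∞) = w p := by
  have e : ∀ n p, ((lipApprox w n p).toNNReal : ℝ≥0∞) = lipApprox w n p := fun n p =>
    ENNReal.coe_toNNReal (lipApprox_lt_top w n p).ne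
  refine ⟨fun n p => (lipApprox w n p).toNNReal, fun n => ?_, fun p => ?_, fun p => ?_⟩
  · exact ENNReal.continuousOn_toNNReal.comp_continuous (continuous_lipApprox w n)
      fun p => (lipApprox_lt_top w n p).ne
  · simpa only [e] using lipApprox_mono w p
  · simpa only [e] using iSup_lipApprox hw p

end Approximation

/-! ### Elementary comparison of risks -/

section RiskComparison

variable {Θ U H : Type*} [MetricSpace Θ] [MeasurableSpace U]
  [NormedAddCommGroup H] [InnerProductSpace ℂ H] [CompleteSpace H]

theorem risk_mono (ρ : QuantumModel Θ H) {w w' : Θ × U → ℝ≥0∞} (h : ∀ p, w p ≤ w' p)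
    (M : POVM U H) (θ : Θ) : risk ρ w M θ ≤ risk ρ w' M θ :=
  lintegral_mono fun u => h (θ, u)

theorem IsMinimax.worstRisk_eq {ρ : QuantumModel Θ H} {w : Θ × U → ℝ≥0∞} {C : Set (POVM U H)}
    {M : POVM U H} (h : IsMinimax ρ w C M) : worstRisk ρ w M = ⨅ N ∈ C, worstRisk ρ w N :=
  le_antisymm (le_iInf₂ h.2) (iInf₂_le M h.1)

theorem iInf_worstRisk_lt_top (ρ : QuantumModel Θ H) [CompactSpace Θ] [MetricSpace U]
    [CompactSpace U] {v : Θ × U → ℝ≥0} (hv : Continuous v)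
    {C : Set (POVM U H)} (hne : C.Nonempty) :
    (⨅ M ∈ C, worstRisk ρ (fun p => (v p : ℝ≥0∞)) M) < ∞ := by
  obtain ⟨c, hc⟩ := exists_bound_of_continuous hv
  obtain ⟨M, hM⟩ := hne
  exact (iInf₂_le_of_le M hM (iSup_le fun θ =>
    risk_le_of_le ρ (fun p => ENNReal.coe_le_coe.2 (hc p)) M θ)).trans_lt ENNReal.coe_lt_top

variable [MeasurableSpace Θ]

theorem avgRisk_le_worstRisk (ρ : QuantumModel Θ H) (w : Θ × U → ℝ≥0∞) (M : POVM U H)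
    (π : ProbabilityMeasure Θ) : avgRisk ρ w M π ≤ worstRisk ρ w M := by
  refine (lintegral_mono fun θ => le_iSup (risk ρ w M) θ).trans ?_
  rw [lintegral_const, measure_univ, mul_one]
  exact le_rfl

theorem iSup_iInf_avgRisk_le (ρ : QuantumModel Θ H) (w : Θ × U → ℝ≥0∞) (C : Set (POVM U H)) :
    (⨆ π : ProbabilityMeasure Θ, ⨅ M ∈ C, avgRisk ρ w M π) ≤ ⨅ M ∈ C, worstRisk ρ w M :=
  iSup_le fun π => iInf₂_mono fun M _ => avgRisk_le_worstRisk ρ w M π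

end RiskComparison

/-! ### Existence of minimax POVMs -/

section MinimaxExistence

variable {Θ U H : Type*} [MetricSpace Θ] [MetricSpace U] [MeasurableSpace U]
  [BorelSpace U]
  [NormedAddCommGroup H] [InnerProductSpace ℂ H] [CompleteSpace H]

/-- Monotone convergence at each parameter, followed by an exchange of two suprema. -/
theorem worstRisk_eq_iSup (ρ : QuantumModel Θ H) {w : Θ × U → ℝ≥0∞} {v : ℕ → Θ × U → ℝ≥0}
    (hv : ∀ n, Continuous (v n)) (hmono : ∀ p, Monotone fun n => (v n p : ℝ≥0∞))
    (hsup : ∀ p, ⨆ n, (v n p : ℝ≥0∞) = w p) (M : POVM U H) :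
    worstRisk ρ w M = ⨆ n, worstRisk ρ (fun p => (v n p : ℝ≥0∞)) M := by
  simp only [worstRisk]
  rw [iSup_comm]
  refine iSup_congr fun θ => ?_
  simp only [risk, ← hsup]
  refine lintegral_iSup (fun n => ?_) fun m n hmn u => hmono (θ, u) hmn
  have : Continuous fun u => (v n (θ, u) : ℝ≥0∞) :=
    ENNReal.continuous_coe.comp ((hv n).comp (by fun_prop))
  exact this.measurable

variable [CompactSpace U]

theorem lowerSemicontinuous_worstRisk (ρ : QuantumModel Θ H) {w : Θ × U → ℝ≥0∞}
    (hw : LowerSemicontinuous w) : LowerSemicontinuous fun M : POVM U H => worstRisk ρ w M := by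
  obtain ⟨v, hv, hmono, hsup⟩ := exists_monotone_continuous_iSup_eq hw
  simp only [worstRisk_eq_iSup ρ hv hmono hsup]
  exact lowerSemicontinuous_iSup fun n => lowerSemicontinuous_worstRisk_of_continuous ρ (hv n)

theorem exists_isMinimax (ρ : QuantumModel Θ H) {C : Set (POVM U H)} (hne : C.Nonempty)
    (hclosed : IsClosed C) {w : Θ × U → ℝ≥0∞} (hw : LowerSemicontinuous w) :
    ∃ M, IsMinimax ρ w C M :=
  ((lowerSemicontinuous_worstRisk ρ hw).lowerSemicontinuousOn C).exists_isMinOn hne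
    hclosed.isCompact

end MinimaxExistence

/-! ### The minimax equality and least favorable priors -/

section Minimax

variable {Θ U H : Type*} [MetricSpace Θ] [CompactSpace Θ] [Nonempty Θ] [MeasurableSpace Θ]
  [BorelSpace Θ] [MetricSpace U] [CompactSpace U] [MeasurableSpace U]
  [NormedAddCommGroup H] [InnerProductSpace ℂ H] [CompleteSpace H]

theorem exists_worst_prior (ρ : QuantumModel Θ H) {C : Set (POVM U H)} (hne : C.Nonempty)
    (hconv : IsConvexClass C) {v : Θ × U → ℝ≥0} (hv : Continuous v) :
    ∃ π : ProbabilityMeasure Θ, (⨅ M ∈ C, worstRisk ρ (fun p => (v p : ℝ≥0∞)) M)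
      ≤ ⨅ M ∈ C, avgRisk ρ (fun p => (v p : ℝ≥0∞)) M π := by
  have hfin := iInf_worstRisk_lt_top ρ hv hne
  set V := ⨅ M ∈ C, worstRisk ρ (fun p => (v p : ℝ≥0∞)) M with hV
  have hconvex : Convex ℝ (riskMap ρ v hv '' C) := by
    rintro _ ⟨M, hM, rfl⟩ _ ⟨N, hN, rfl⟩ a b ha hb hab
    obtain rfl : b = 1 - a := by linarith
    obtain ⟨L, hL, hLB⟩ := hconv M hM N hN a ha (by linarith)
    refine ⟨L, hL, ContinuousMap.ext fun θ => ?_⟩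
    have h := risk_mixture ρ (fun p => (v p : ℝ≥0∞)) ha (by linarith) hLB θ
    have hnn : ∀ K : POVM U H, 0 ≤ riskMap ρ v hv K θ := fun K => ENNReal.toReal_nonneg
    rw [← ofReal_riskMap ρ hv, ← ofReal_riskMap ρ hv, ← ofReal_riskMap ρ hv,
      ← ENNReal.ofReal_mul ha, ← ENNReal.ofReal_mul hb,
      ← ENNReal.ofReal_add (mul_nonneg ha (hnn M)) (mul_nonneg hb (hnn N)),
      ENNReal.ofReal_eq_ofReal_iff (hnn L)
        (add_nonneg (mul_nonneg ha (hnn M)) (mul_nonneg hb (hnn N)))] at h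
    exact h
  obtain ⟨π, hπ⟩ := exists_probabilityMeasure_le_integral hconvex (V := V.toReal) (by
    rintro _ ⟨M, hM, rfl⟩
    -- A continuous risk function attains its supremum, which is at least `V`; this is the point
    -- required by the separation lemma.
    obtain ⟨θ, -, hθ⟩ := isCompact_univ.exists_isMaxOn univ_nonempty
      (riskMap ρ v hv M).continuous.continuousOn
    refine ⟨θ, ?_⟩
    rw [← ENNReal.toReal_ofReal (r := riskMap ρ v hv M θ) ENNReal.toReal_nonneg]
    refine ENNReal.toReal_mono ENNReal.ofReal_ne_top ((iInf₂_le M hM).trans (iSup_le fun η => ?_))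
    rw [← ofReal_riskMap ρ hv]
    exact ENNReal.ofReal_le_ofReal (hθ (mem_univ η)))
  refine ⟨π, le_iInf₂ fun M hM => ?_⟩
  have h := ENNReal.ofReal_le_ofReal (hπ _ ⟨M, hM, rfl⟩)
  rw [ENNReal.ofReal_toReal hfin.ne, ofReal_integral_eq_lintegral_ofReal
    (f := riskMap ρ v hv M)
    ((BoundedContinuousFunction.mkOfCompact (riskMap ρ v hv M)).integrable _)
    (Eventually.of_forall fun θ => ENNReal.toReal_nonneg)] at h
  simp only [ofReal_riskMap] at h
  exact h

theorem minimax_eq_of_continuous (ρ : QuantumModel Θ H) {C : Set (POVM U H)} (hne : C.Nonempty)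
    (hconv : IsConvexClass C) {v : Θ × U → ℝ≥0} (hv : Continuous v) :
    (⨅ M ∈ C, worstRisk ρ (fun p => (v p : ℝ≥0∞)) M) =
      ⨆ π : ProbabilityMeasure Θ, ⨅ M ∈ C, avgRisk ρ (fun p => (v p : ℝ≥0∞)) M π := by
  obtain ⟨π, hπ⟩ := exists_worst_prior ρ hne hconv hv
  exact le_antisymm (hπ.trans (le_iSup_of_le π le_rfl)) (iSup_iInf_avgRisk_le ρ _ C)

/-- A minimax POVM is Bayes with respect to a least favorable prior. -/
theorem IsMinimax.exists_isBayes {ρ : QuantumModel Θ H} {C : Set (POVM U H)}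
    (hconv : IsConvexClass C) {v : Θ × U → ℝ≥0} (hv : Continuous v) {M : POVM U H}
    (hM : IsMinimax ρ (fun p => (v p : ℝ≥0∞)) C M) :
    ∃ π, IsLeastFavorable ρ (fun p => (v p : ℝ≥0∞)) C π ∧
      IsBayes ρ (fun p => (v p : ℝ≥0∞)) C π M := by
  obtain ⟨π, hπ⟩ := exists_worst_prior ρ ⟨M, hM.1⟩ hconv hv
  refine ⟨π, le_antisymm (le_iSup_of_le π le_rfl) ((iSup_iInf_avgRisk_le ρ _ C).trans hπ),
    hM.1, fun N hN => ?_⟩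
  exact (avgRisk_le_worstRisk ρ _ M π).trans (hM.worstRisk_eq.trans_le (hπ.trans (iInf₂_le N hN)))

variable [BorelSpace U]

/-- A minimax POVM for the approximating loss `v n` has worst-case risk at most the dual value `L`,
because `v n ≤ w`. The sets `S n` are thus nonempty, nested and compact, and a common element has
worst-case risk at most `L` for `w` itself. -/
theorem minimax_eq (ρ : QuantumModel Θ H) {C : Set (POVM U H)} (hne : C.Nonempty)
    (hclosed : IsClosed C) (hconv : IsConvexClass C) {w : Θ × U → ℝ≥0∞}
    (hw : LowerSemicontinuous w) :
    (⨅ M ∈ C, worstRisk ρ w M) = ⨆ π : ProbabilityMeasure Θ, ⨅ M ∈ C, avgRisk ρ w M π := by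
  refine le_antisymm ?_ (iSup_iInf_avgRisk_le ρ w C)
  obtain ⟨v, hv, hmono, hsup⟩ := exists_monotone_continuous_iSup_eq hw
  set L := ⨆ π : ProbabilityMeasure Θ, ⨅ M ∈ C, avgRisk ρ w M π
  let S : ℕ → Set (POVM U H) := fun n =>
    C ∩ {M | worstRisk ρ (fun p => (v n p : ℝ≥0∞)) M ≤ L}
  have hSclosed : ∀ n, IsClosed (S n) := fun n => hclosed.inter
    ((lowerSemicontinuous_worstRisk_of_continuous ρ (hv n)).isClosed_preimage L)
  have hSne : ∀ n, (S n).Nonempty := by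
    intro n
    obtain ⟨M, hM⟩ := exists_isMinimax ρ hne hclosed
      (ENNReal.continuous_coe.comp (hv n)).lowerSemicontinuous
    refine ⟨M, hM.1, ?_⟩
    refine (hM.worstRisk_eq.trans (minimax_eq_of_continuous ρ hne hconv (hv n))).trans_le ?_
    refine iSup_mono fun π => iInf₂_mono fun N _ => lintegral_mono fun θ => ?_
    exact risk_mono ρ (fun p => hsup p ▸ le_iSup (fun n => (v n p : ℝ≥0∞)) n) N θ
  have hSanti : ∀ n, S (n + 1) ⊆ S n := fun n M hM =>
    ⟨hM.1, (iSup_mono fun θ => risk_mono ρ (fun p => hmono p n.le_succ) M θ).trans hM.2⟩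
  obtain ⟨M, hM⟩ := IsCompact.nonempty_iInter_of_sequence_nonempty_isCompact_isClosed S hSanti
    hSne (hSclosed 0).isCompact hSclosed
  rw [mem_iInter] at hM
  refine iInf₂_le_of_le M (hM 0).1 ?_
  rw [worstRisk_eq_iSup ρ hv hmono hsup]
  exact iSup_le fun n => (hM n).2

/-- The average risk of `M` is at most its worst-case risk, which is the minimax value; by the
minimax equality this is the least average risk under `π`. -/
theorem IsMinimax.isBayes {ρ : QuantumModel Θ H} {C : Set (POVM U H)}
    (hclosed : IsClosed C) (hconv : IsConvexClass C) {w : Θ × U → ℝ≥0∞}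
    (hw : LowerSemicontinuous w) {M : POVM U H} (hM : IsMinimax ρ w C M)
    {π : ProbabilityMeasure Θ} (hπ : IsLeastFavorable ρ w C π) : IsBayes ρ w C π M := by
  refine ⟨hM.1, fun N hN => (avgRisk_le_worstRisk ρ w M π).trans ?_⟩
  rw [hM.worstRisk_eq, minimax_eq ρ ⟨M, hM.1⟩ hclosed hconv hw, ← hπ]
  exact iInf₂_le N hN

end Minimax

end

end QuantumDecision

open QuantumDecision
theorem mainTheorem7 {Θ U H : Type*}
    [MetricSpace Θ] [CompactSpace Θ] [Nonempty Θ] [MeasurableSpace Θ] [BorelSpace Θ]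
    [MetricSpace U] [CompactSpace U] [MeasurableSpace U] [BorelSpace U]
    [NormedAddCommGroup H] [InnerProductSpace ℂ H] [CompleteSpace H]
    (ρ : QuantumModel Θ H) (C : Set (POVM U H))
    (hne : C.Nonempty) (hclosed : IsClosed C) (hconv : IsConvexClass C) :
    -- the minimax equality, with a finite value, for continuous losses
    (∀ v : Θ × U → ℝ≥0, Continuous v →
      (⨅ M ∈ C, worstRisk ρ (fun p => (v p : ℝ≥0∞)) M) =
        (⨆ π : ProbabilityMeasure Θ, ⨅ M ∈ C, avgRisk ρ (fun p => (v p : ℝ≥0∞)) M π) ∧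
      (⨅ M ∈ C, worstRisk ρ (fun p => (v p : ℝ≥0∞)) M) < ∞) ∧
    -- the minimax equality for lower semicontinuous losses
    (∀ w : Θ × U → ℝ≥0∞, LowerSemicontinuous w →
      (⨅ M ∈ C, worstRisk ρ w M) =
        (⨆ π : ProbabilityMeasure Θ, ⨅ M ∈ C, avgRisk ρ w M π)) ∧
    -- existence of a minimax POVM for lower semicontinuous losses
    (∀ w : Θ × U → ℝ≥0∞, LowerSemicontinuous w → ∃ M, IsMinimax ρ w C M) ∧
    -- minimax POVMs and least favorable priors for continuous losses
    (∀ v : Θ × U → ℝ≥0, Continuous v →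
      (∀ M, IsMinimax ρ (fun p => (v p : ℝ≥0∞)) C M →
        ∃ π, IsLeastFavorable ρ (fun p => (v p : ℝ≥0∞)) C π ∧
          IsBayes ρ (fun p => (v p : ℝ≥0∞)) C π M) ∧
      (∀ π, IsLeastFavorable ρ (fun p => (v p : ℝ≥0∞)) C π →
        ∀ M, IsBayes ρ (fun p => (v p : ℝ≥0∞)) C π M →
          (∀ N, IsBayes ρ (fun p => (v p : ℝ≥0∞)) C π N → N = M) →
          IsMinimax ρ (fun p => (v p : ℝ≥0∞)) C M)) := by
  refine ⟨fun v hv => ⟨minimax_eq_of_continuous ρ hne hconv hv, iInf_worstRisk_lt_top ρ hv hne⟩,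
    fun w hw => minimax_eq ρ hne hclosed hconv hw, fun w hw => exists_isMinimax ρ hne hclosed hw,
    fun v hv => ⟨fun M hM => hM.exists_isBayes hconv hv, fun π hπ M _ huniq => ?_⟩⟩
  have hw : LowerSemicontinuous fun p => (v p : ℝ≥0∞) :=
    (ENNReal.continuous_coe.comp hv).lowerSemicontinuous
  -- Some minimax POVM exists and is Bayes for `π`, so it must be the unique Bayes POVM.
  obtain ⟨N, hN⟩ := exists_isMinimax ρ hne hclosed hw
  rw [← huniq N (hN.isBayes hclosed hconv hw hπ)]
  exact hN
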